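/- Let $A$ be a commutative, associative, unital $\mathbb{Q}$-algebra. Let $Y$ be the set of planar binary rooted trees, $|t|$ the number of internal vertices of $t\in Y$, $\mathbf{1}$ the root tree ($|\mathbf{1}|=0$), $\mathsf{v}$ the tree with a single internal vertex, and $\overline{Y}=Y\setminus\{\mathbf{1}\}$. For $t,s\in Y$, let $t\slash s$ be the tree obtained by grafting the root of $t$ on the left-most leaf of $s$, let $t\backslash s$ be the tree obtained by grafting the root of $s$ on the right-most leaf of $t$, and put $V(t)=\mathsf{v}\backslash t$. For $t\in\overline{Y}$ and $s_1,\dots,s_{|t|}\in\overline{Y}$, let $\mu_t(s_1,\dots,s_{|t|})$ be the tree obtained by writing $t$ as a monomial in $\mathsf{v}$ for the products $\slash$ and $\backslash$ and replacing the successive copies of $\mathsf{v}$, from left to right, by $s_1,\dots,s_{|t|}$. Tree-expanded series are the formal sums $f(x)=\sum_{t\in Y}f_t\,x^t$ with $f_t\in A$; their set is $A[[Y]]$, and both products of trees are extended to it bilinearly, by $x^t\slash x^s=x^{t\slash s}$ and $x^t\backslash x^s=x^{t\backslash s}$ (all the sums over trees below are finite in each coefficient). Let $G^{\mathrm{over}}(A)$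 be the group of the series with $f_{\mathbf{1}}=1$, with multiplication $\slash$ and unit $x^{\mathbf{1}}$. Let $G^{\mathrm{dif}}_Y(A)$ be the set of the series $\varphi(x)=\sum_{t\in\overline{Y}}\varphi_t\,x^t$ with $\varphi_{\mathsf{v}}=1$, with the composition $$(\varphi\circ\psi)(x)=\sum_{t\in\overline{Y}}\ \sum_{s_1,\dots,s_{|t|}\in\overline{Y}}\varphi_t\,\psi_{s_1}\cdots\psi_{s_{|t|}}\;x^{\mu_t(s_1,\dots,s_{|t|})}.$$ For a series $g$, put $\rho_g(x)=g(x)\slash x^{\mathsf{v}}=\sum_{t\in Y}g_t\,x^{t\slash\mathsf{v}}$, and let $G^{\rho}_Y(A)=\{\rho_g : g\in G^{\mathrm{over}}(A)\}$. For $f\in A[[Y]]$, put $$\alpha_f(x)=\bigl(x^{\mathbf{1}}-x^{\mathsf{v}}\backslash f(x)\bigr)^{-1}\slash x^{\mathsf{v}},$$ where the inverse is taken in $G^{\mathrm{over}}(A)$, and let $G^{\alpha}(A)=\{\alpha_f : f\in A[[Y]]\}$. **Theorem.** 1. $G^{\alpha}(A)$ is the set of the series $\rho_g$, $g\in G^{\mathrm{over}}(A)$,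 such that $g_t=g_{V(t_1)}\,g_{V(t_2)}\cdots g_{V(t_n)}$ whenever $n\ge 1$, $t_1,\dots,t_n\in Y$ and $t=V(t_1)\slash V(t_2)\slash\cdots\slash V(t_n)$. 2. $G^{\mathrm{dif}}_Y(A)$ is a group for the composition $\circ$, with unit $x^{\mathsf{v}}$; $G^{\rho}_Y(A)$ is a subgroup of it; and $G^{\alpha}(A)$ is a subgroup of $G^{\rho}_Y(A)$, hence of $G^{\mathrm{dif}}_Y(A)$. -/

import Mathlib

namespace TreeSeries

/-- Planar binary rooted trees; `nil` is the root tree (no internal vertex), `node () l r` has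
a lowest internal vertex with left branch `l` and right branch `r`, and the order `|t|` of a tree
is its number of internal vertices `t.numNodes`. -/
abbrev PBTree : Type := BinaryTree Unit

/-- The vertex tree, the only tree with exactly one internal vertex. -/
def vertex : PBTree := .node () .nil .nil

/-- `overT t s` is `t / s`: graft the root of `t` on the left-most leaf of `s`. -/
def overT (t : PBTree) : PBTree → PBTree
  | .nil => t
  | .node _ l r => .node () (overT t l) r

/-- `underT t s` is `t \ s`: graft the root of `s` on the right-most leaf of `t`. -/
def underT : PBTree → PBTree → PBTree
  | .nil, s => s
  | .node _ l r, s => .node () l (underT r s)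

/-- `V t` is the tree `vertex \ t`. -/
def V (t : PBTree) : PBTree := underT vertex t

/-- The iterated over product `t₁ / t₂ / ⋯ / tₙ` of a list of trees. -/
def overProd (l : List PBTree) : PBTree := l.foldr overT .nil

/-- The tree-product `μ_t(s₁, …, s_{|t|})`: write `t` as a monomial in the vertex tree for the over
and under products (a tree with left branch `l` and right branch `r` is `l / vertex \ r`) and
replace the successive copies of the vertex tree, from left to right, by `s₁, …, s_{|t|}`. -/
def mu : (t : PBTree) → (Fin t.numNodes → PBTree) → PBTree
  | .nil, _ => .nil
  | .node _ l r, s =>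
      underT
        (overT
          (mu l fun i => s ⟨i, by have := i.isLt; simp only [BinaryTree.numNodes]; omega⟩)
          (s ⟨l.numNodes, by simp only [BinaryTree.numNodes]; omega⟩))
        (mu r fun i => s ⟨l.numNodes + 1 + i, by
          have := i.isLt; simp only [BinaryTree.numNodes]; omega⟩)

theorem numNodes_over (t s : PBTree) : (overT t s).numNodes = t.numNodes + s.numNodes := by
  induction s with
  | nil => simp [overT]
  | node a l r ihl ihr => simp only [overT, BinaryTree.numNodes, ihl]; omega

theorem numNodes_under (t s : PBTree) : (underT t s).numNodes = t.numNodes + s.numNodes := by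
  induction t with
  | nil => simp [underT]
  | node a l r ihl ihr => simp only [underT, BinaryTree.numNodes, ihr]; omega

theorem over_assoc (t s u : PBTree) : overT (overT t s) u = overT t (overT s u) := by
  induction u with
  | nil => rfl
  | node a l r ihl ihr => simp only [overT, ihl]

theorem nil_over (t : PBTree) : overT .nil t = t := by
  induction t with
  | nil => rfl
  | node a l r ihl ihr => simp only [overT, ihl]

theorem numNodes_mu : ∀ (t : PBTree) (s : Fin t.numNodes → PBTree),
    (mu t s).numNodes = ∑ i, (s i).numNodes
  | .nil, s => by
      rw [mu]
      exact (Finset.sum_of_isEmpty (ι := Fin 0) _).symm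
  | .node _ l r, s => by
      have h1 := numNodes_mu l fun i => s ⟨i, by
        have := i.isLt; simp only [BinaryTree.numNodes]; omega⟩
      have h2 := numNodes_mu r fun i => s ⟨l.numNodes + 1 + i, by
        have := i.isLt; simp only [BinaryTree.numNodes]; omega⟩
      have h3 : l.numNodes + 1 + r.numNodes = (BinaryTree.node () l r).numNodes := by
        simp only [BinaryTree.numNodes]; omega
      rw [mu, numNodes_under, numNodes_over, h1, h2]
      rw [← Equiv.sum_comp (finCongr h3), Fin.sum_univ_add, Fin.sum_univ_castSucc]
      rfl

/-- The finite set of trees of order at most `n`. -/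
def treesUpTo (n : ℕ) : Finset PBTree :=
  (Finset.range (n + 1)).biUnion BinaryTree.treesOfNumNodesEq

theorem mem_treesUpTo {n : ℕ} {t : PBTree} : t ∈ treesUpTo n ↔ t.numNodes ≤ n := by
  simp [treesUpTo, BinaryTree.mem_treesOfNumNodesEq]

theorem finite_overPairs (u : PBTree) : {p : PBTree × PBTree | overT p.1 p.2 = u}.Finite := by
  refine (treesUpTo u.numNodes ×ˢ treesUpTo u.numNodes).finite_toSet.subset ?_
  rintro ⟨p, q⟩ rfl
  simp [mem_treesUpTo, numNodes_over]

theorem finite_underPairs (u : PBTree) : {p : PBTree × PBTree | underT p.1 p.2 = u}.Finite := by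
  refine (treesUpTo u.numNodes ×ˢ treesUpTo u.numNodes).finite_toSet.subset ?_
  rintro ⟨p, q⟩ rfl
  simp [mem_treesUpTo, numNodes_under]

theorem finite_muTuples (u : PBTree) :
    {p : Σ t : PBTree, (Fin t.numNodes → PBTree) |
      p.1 ≠ .nil ∧ (∀ i, p.2 i ≠ .nil) ∧ mu p.1 p.2 = u}.Finite := by
  refine ((treesUpTo u.numNodes).sigma fun t =>
    Fintype.piFinset fun _ : Fin t.numNodes => treesUpTo u.numNodes).finite_toSet.subset ?_
  rintro ⟨t, s⟩ ⟨-, hs, rfl⟩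
  simp only [Finset.coe_sigma, Set.mem_sigma_iff, Finset.mem_coe, Fintype.mem_piFinset,
    mem_treesUpTo, numNodes_mu]
  refine ⟨?_, fun i => Finset.single_le_sum (f := fun i => (s i).numNodes)
    (fun _ _ => Nat.zero_le _) (Finset.mem_univ i)⟩
  have hpos : ∀ i, 1 ≤ (s i).numNodes := by
    intro i
    have h : s i ≠ .nil := hs i
    revert h
    cases s i <;> simp
  calc t.numNodes = ∑ _i : Fin t.numNodes, 1 := by simp
    _ ≤ _ := Finset.sum_le_sum fun i _ => hpos i

/-- The finitely many pairs of trees `(p, q)` with `p / q = u`. -/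
noncomputable def overPairs (u : PBTree) : Finset (PBTree × PBTree) :=
  (finite_overPairs u).toFinset

/-- The finitely many pairs of trees `(p, q)` with `p \ q = u`. -/
noncomputable def underPairs (u : PBTree) : Finset (PBTree × PBTree) :=
  (finite_underPairs u).toFinset

/-- The finitely many `(t; s₁, …, s_{|t|})`, all different from the root tree, with
`μ_t(s₁, …, s_{|t|}) = u`. -/
noncomputable def muTuples (u : PBTree) : Finset (Σ t : PBTree, (Fin t.numNodes → PBTree)) :=
  (finite_muTuples u).toFinset

theorem mem_overPairs {u : PBTree} {p : PBTree × PBTree} :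
    p ∈ overPairs u ↔ overT p.1 p.2 = u := by
  simp [overPairs]

theorem mem_underPairs {u : PBTree} {p : PBTree × PBTree} :
    p ∈ underPairs u ↔ underT p.1 p.2 = u := by
  simp [underPairs]

theorem mem_muTuples {u : PBTree} {p : Σ t : PBTree, (Fin t.numNodes → PBTree)} :
    p ∈ muTuples u ↔ p.1 ≠ .nil ∧ (∀ i, p.2 i ≠ .nil) ∧ mu p.1 p.2 = u := by
  simp [muTuples]

/-- Tree-expanded series `∑ₜ fₜ xᵗ` with coefficients in `A`. -/
abbrev Series (A : Type*) : Type _ := PBTree → A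

section Series

variable {A : Type*} [CommRing A]

/-- The series `xᵗ`. -/
def X (t : PBTree) : Series A := Pi.single t 1

/-- `(f / g)(x) = ∑_{p, q} f_p g_q x^{p / q}`. -/
noncomputable def overMul (f g : Series A) : Series A :=
  fun u => ∑ p ∈ overPairs u, f p.1 * g p.2

/-- `(f \ g)(x) = ∑_{p, q} f_p g_q x^{p \ q}`. -/
noncomputable def underMul (f g : Series A) : Series A :=
  fun u => ∑ p ∈ underPairs u, f p.1 * g p.2

/-- Composition of tree-expanded series without constant term:
`(φ ∘ ψ)(x) = ∑ φ_t ψ_{s₁} ⋯ ψ_{s_{|t|}} x^{μ_t(s₁, …, s_{|t|})}`, where `t, s₁, …, s_{|t|}` run over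
all the trees different from the root tree. -/
noncomputable def comp (φ ψ : Series A) : Series A :=
  fun u => ∑ p ∈ muTuples u, φ p.1 * ∏ i, ψ (p.2 i)

theorem overMul_assoc (f g h : Series A) :
    overMul (overMul f g) h = overMul f (overMul g h) := by
  funext u
  simp only [overMul, Finset.sum_mul, Finset.mul_sum]
  rw [Finset.sum_sigma', Finset.sum_sigma']
  refine Finset.sum_bij'
    (fun x _ => ⟨(x.2.1, overT x.2.2 x.1.2), (x.2.2, x.1.2)⟩)
    (fun x _ => ⟨(overT x.1.1 x.2.1, x.2.2), (x.1.1, x.2.1)⟩) ?_ ?_ ?_ ?_ ?_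
  · rintro ⟨⟨a, b⟩, ⟨c, d⟩⟩ hx
    simp only [Finset.mem_sigma, mem_overPairs] at hx ⊢
    obtain ⟨rfl, rfl⟩ := hx
    simp [over_assoc]
  · rintro ⟨⟨a, b⟩, ⟨c, d⟩⟩ hx
    simp only [Finset.mem_sigma, mem_overPairs] at hx ⊢
    obtain ⟨rfl, rfl⟩ := hx
    simp [over_assoc]
  · rintro ⟨⟨a, b⟩, ⟨c, d⟩⟩ hx
    simp only [Finset.mem_sigma, mem_overPairs] at hx ⊢
    obtain ⟨rfl, rfl⟩ := hx
    rfl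
  · rintro ⟨⟨a, b⟩, ⟨c, d⟩⟩ hx
    simp only [Finset.mem_sigma, mem_overPairs] at hx ⊢
    obtain ⟨rfl, rfl⟩ := hx
    rfl
  · rintro ⟨⟨a, b⟩, ⟨c, d⟩⟩ _
    simp [mul_assoc]

theorem overMul_X_nil (f : Series A) : overMul f (X .nil) = f := by
  funext u
  rw [overMul, Finset.sum_eq_single (u, .nil)]
  · simp [X]
  · rintro ⟨p, q⟩ hpq hne
    have : q ≠ .nil := by
      rintro rfl
      exact hne (by rw [mem_overPairs] at hpq; rw [← hpq]; rfl)
    simp [X, this]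
  · intro h
    exact absurd (mem_overPairs.2 rfl) h

theorem overMul_nil (f g : Series A) : overMul f g .nil = f .nil * g .nil := by
  rw [overMul, Finset.sum_eq_single (.nil, .nil)]
  · rintro ⟨p, q⟩ hpq hne
    cases q with
    | nil => exact absurd (by rw [mem_overPairs] at hpq; rw [← hpq]; rfl) hne
    | node a l r => rw [mem_overPairs] at hpq; simp [overT] at hpq
  · intro h
    exact absurd (mem_overPairs.2 rfl) h

/-- The coefficients of the inverse of `f` for the product `/`, when `f` has constant term `1`:
the solution `h` of `∑_{p / q = u} f_p h_q = 0`, `u ≠ nil`, by recursion on the order of `u`. -/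
noncomputable def overInv (f : Series A) (u : PBTree) : A :=
  if u = .nil then 1
  else -∑ p ∈ (overPairs u).attach,
    if h : p.1.1 = .nil then 0
    else
      have : p.1.2.numNodes < u.numNodes := by
        have h1 := mem_overPairs.1 p.2
        have h2 : 0 < p.1.1.numNodes := by
          revert h
          cases p.1.1 <;> simp
        have h3 := numNodes_over p.1.1 p.1.2
        rw [h1] at h3
        omega
      f p.1.1 * overInv f p.1.2
termination_by u.numNodes

theorem overMul_overInv (f : Series A) (hf : f .nil = 1) :
    overMul f (overInv f) = X .nil := by
  funext u
  by_cases hu : u = .nil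
  · subst hu
    rw [overMul_nil, overInv, hf]
    simp [X]
  · have h1 : overInv f u = -∑ p ∈ overPairs u,
        if p.1 = .nil then 0 else f p.1 * overInv f p.2 := by
      rw [overInv, if_neg hu, ← Finset.sum_attach (overPairs u)]
      simp only [dite_eq_ite]
    have h2 : overInv f u = ∑ p ∈ overPairs u,
        if p.1 = .nil then f p.1 * overInv f p.2 else 0 := by
      rw [Finset.sum_eq_single (.nil, u)]
      · simp [hf]
      · rintro ⟨p, q⟩ hpq hne
        rw [if_neg]
        rintro rfl
        rw [mem_overPairs, nil_over] at hpq
        exact hne (by rw [← hpq])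
      · intro h
        exact absurd (mem_overPairs.2 (nil_over u)) h
    have h3 : overMul f (overInv f) u = overInv f u + -overInv f u := by
      nth_rewrite 1 [h2]
      rw [h1, neg_neg, ← Finset.sum_add_distrib, overMul]
      refine Finset.sum_congr rfl fun p _ => ?_
      split_ifs <;> simp
    rw [h3]
    simp [X, hu]

end Series

/-- The tree-expanded series with constant term `1`; with the multiplication `/` they form the
group of tree-expanded invertible series. -/
def GOver (A : Type*) [CommRing A] : Type _ := {f : Series A // f .nil = 1}

section GOver

variable {A : Type*} [CommRing A]

noncomputable instance : Mul (GOver A) :=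
  ⟨fun f g => ⟨overMul f.1 g.1, by rw [overMul_nil, f.2, g.2, one_mul]⟩⟩

instance : One (GOver A) := ⟨⟨X .nil, by simp [X]⟩⟩

noncomputable instance : Inv (GOver A) := ⟨fun f => ⟨overInv f.1, by rw [overInv]; simp⟩⟩

/-- The group `(GOver A, /)`, with unit `x^nil`. -/
noncomputable instance : Group (GOver A) :=
  Group.ofRightAxioms
    (fun f g h => Subtype.ext (overMul_assoc f.1 g.1 h.1))
    (fun f => Subtype.ext (overMul_X_nil f.1))
    (fun f => Subtype.ext (overMul_overInv f.1 f.2))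

/-- The invertible series `x^nil - x^vertex \ f`. -/
noncomputable def oneSub (f : Series A) : GOver A :=
  ⟨X .nil - underMul (X vertex) f, by
    have : underMul (X vertex) f .nil = 0 := by
      refine Finset.sum_eq_zero ?_
      rintro ⟨p, q⟩ hpq
      rw [mem_underPairs] at hpq
      have hp : p ≠ vertex := by
        rintro rfl
        simp [vertex, underT] at hpq
      simp [X, hp]
    rw [Pi.sub_apply, this]
    simp [X]⟩

/-- `ρ_g = g / x^vertex = ∑ₜ gₜ x^{t / vertex}`. -/
noncomputable def rho (g : Series A) : Series A := overMul g (X vertex)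

/-- `α_f = (x^nil - x^vertex \ f)⁻¹ / x^vertex`, the inverse being taken in the group `GOver A`. -/
noncomputable def alpha (f : Series A) : Series A := rho ((oneSub f)⁻¹).1

end GOver

/-- The tree-expanded formal diffeomorphisms: series with constant term `0` and in which `x^vertex`
has coefficient `1`. -/
def GDif (A : Type*) [CommRing A] : Type _ :=
  {φ : Series A // φ .nil = 0 ∧ φ vertex = 1}

/-- The set of the series `ρ_g`, for `g` with constant term `1`. -/
def GRho (A : Type*) [CommRing A] : Set (Series A) := {φ | ∃ g : GOver A, φ = rho g.1}

/-- The set of the series `α_f`, for all the tree-expanded series `f`. -/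
def GAlpha (A : Type*) [CommRing A] : Set (Series A) := {φ | ∃ f : Series A, φ = alpha f}

end TreeSeries

open TreeSeries

/-! Substituting `ψ` with zero constant term, `f ↦ evalAt ψ f`, is a linear map that respects both
products and sends `x^vertex` to `ψ`, because every tree is a monomial in the vertex tree. On series
without constant term it is the composition (`comp_eq_evalAt`). Associativity (`evalAt_evalAt`)
holds since a homomorphism carries monomials in `ψ` to monomials in its image. Left inverses exist
because `subst ψ t` is `x^t` plus terms of higher order when `ψ` has `x^vertex`-coefficient `1`, so
the substitution is unitriangular.

The subgroups come from two formulas. Since `ρ_g = g / x^vertex`, one gets `ρ_f ∘ ρ_g = ρ_k` with `k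
= f(ρ_g) / g` (`rhoDif_mul`). Since `(x^nil - x^vertex \ h) / α_h = x^vertex`, this specializes to
`α_f ∘ α_h = α_k` with `k = h + f(α_h)` (`alphaDif_mul`). Both can be solved for the inverse.

For the multiplicativity, `g / (x^nil - x^vertex \ f) = x^nil` says coefficientwise that `g` at
`node () l r` is `g_l f_r` (`eq_inv_oneSub_iff`). Taking `l` to be the root tree gives `f_r = g_{V
r}`, and `node () l r = l / V r` makes this the stated condition. -/

namespace TreeSeries

/-! ### Trees as monomials in the vertex tree -/

section Trees

theorem under_assoc (t s u : PBTree) : underT (underT t s) u = underT t (underT s u) := by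
  induction t with
  | nil => rfl
  | node a l r ihl ihr => simp only [underT, ihr]

theorem under_nil (t : PBTree) : underT t .nil = t := by
  induction t with
  | nil => rfl
  | node a l r ihl ihr => simp only [underT, ihr]

/-- The two graftings act on different branches of the root of `s`. For `s = .nil` the sides would
be `t / u` and `t \ u`. -/
theorem over_under (t u : PBTree) {s : PBTree} (hs : s ≠ .nil) :
    overT t (underT s u) = underT (overT t s) u := by
  cases s with
  | nil => exact absurd rfl hs
  | node a l r => rfl

theorem V_eq (t : PBTree) : V t = .node () .nil t := rfl

theorem over_V (p s : PBTree) : overT p (V s) = .node () p s := rfl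

theorem overProd_append (l : List PBTree) (t : PBTree) :
    overProd (l ++ [t]) = overT (overProd l) t := by
  induction l with
  | nil => simp [overProd, overT, nil_over]
  | cons a l ih =>
    change overT a (overProd (l ++ [t])) = overT (overT a (overProd l)) t
    rw [ih, over_assoc]

theorem exists_eq_overProd_map_V (t : PBTree) : ∃ l : List PBTree, t = overProd (l.map V) := by
  induction t with
  | nil => exact ⟨[], rfl⟩
  | node a p r ihp _ =>
    obtain ⟨l, rfl⟩ := ihp
    exact ⟨l ++ [r], by rw [List.map_append, List.map_singleton, overProd_append, over_V]⟩

theorem eq_vertex_of_numNodes {t : PBTree} (h : t.numNodes = 1) : t = vertex := by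
  cases t with
  | nil => simp at h
  | node a l r =>
    cases l <;> cases r <;> simp [BinaryTree.numNodes] at h ⊢
    rfl

theorem numNodes_vertex : vertex.numNodes = 1 := rfl

theorem numNodes_pos {t : PBTree} (h : t ≠ .nil) : 1 ≤ t.numNodes := by
  cases t with
  | nil => exact absurd rfl h
  | node a l r => simp

theorem mu_vertex (t : PBTree) : mu t (fun _ => vertex) = t := by
  induction t with
  | nil => rfl
  | node a l r ihl ihr =>
    simp only [mu, ihl, ihr]
    rfl

/-- An assignment of trees to the vertices of `node () l r` amounts to one for `l`, one for the
lowest vertex and one for `r`. -/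
def nodeFamily {l r : PBTree} (a : Fin l.numNodes → PBTree) (b : PBTree)
    (c : Fin r.numNodes → PBTree) (i : Fin (BinaryTree.node () l r).numNodes) : PBTree :=
  if h : i.1 < l.numNodes then a ⟨i.1, h⟩
  else if h' : i.1 = l.numNodes then b
  else c ⟨i.1 - (l.numNodes + 1), by
    have := i.isLt; simp only [BinaryTree.numNodes] at this; omega⟩

theorem nodeFamily_left {l r : PBTree} (a : Fin l.numNodes → PBTree) (b : PBTree)
    (c : Fin r.numNodes → PBTree) (i : Fin l.numNodes) (h) :
    nodeFamily a b c ⟨i.1, h⟩ = a i := by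
  simp [nodeFamily]

theorem nodeFamily_mid {l r : PBTree} (a : Fin l.numNodes → PBTree) (b : PBTree)
    (c : Fin r.numNodes → PBTree) (h) : nodeFamily a b c ⟨l.numNodes, h⟩ = b := by
  simp [nodeFamily]

theorem nodeFamily_right {l r : PBTree} (a : Fin l.numNodes → PBTree) (b : PBTree)
    (c : Fin r.numNodes → PBTree) (i : Fin r.numNodes) (h) :
    nodeFamily a b c ⟨l.numNodes + 1 + i.1, h⟩ = c i := by
  have h1 : ¬ l.numNodes + 1 + i.1 < l.numNodes := by omega
  have h2 : ¬ l.numNodes + 1 + i.1 = l.numNodes := by omega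
  simp [nodeFamily, h1, h2]

theorem nodeFamily_forall {l r : PBTree} {a : Fin l.numNodes → PBTree} {b : PBTree}
    {c : Fin r.numNodes → PBTree} {P : PBTree → Prop} (ha : ∀ i, P (a i)) (hb : P b)
    (hc : ∀ i, P (c i)) (i) : P (nodeFamily a b c i) := by
  unfold nodeFamily
  split_ifs
  exacts [ha _, hb, hc _]

theorem prod_node {A : Type*} [CommMonoid A] {l r : PBTree}
    (f : Fin (BinaryTree.node () l r).numNodes → A) :
    ∏ i, f i = (∏ i : Fin l.numNodes, f ⟨i, by
        have := i.isLt; simp only [BinaryTree.numNodes]; omega⟩) *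
      f ⟨l.numNodes, by simp only [BinaryTree.numNodes]; omega⟩ *
      ∏ i : Fin r.numNodes, f ⟨l.numNodes + 1 + i, by
        have := i.isLt; simp only [BinaryTree.numNodes]; omega⟩ := by
  have h3 : l.numNodes + 1 + r.numNodes = (BinaryTree.node () l r).numNodes := by
    simp only [BinaryTree.numNodes]; omega
  rw [← Equiv.prod_comp (finCongr h3), Fin.prod_univ_add, Fin.prod_univ_castSucc]
  rfl

end Trees

/-! ### Finite truncations and the algebra of the two products -/

section Expansion

variable {A : Type*} [CommRing A]

/-- Up to order `n`, the series `f` is the finite sum `∑ i ∈ S, w i • x ^ τ i`. -/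
def IsExpansion (n : ℕ) (f : Series A) {ι : Type*} (S : Finset ι) (w : ι → A) (τ : ι → PBTree) :
    Prop :=
  ∀ u : PBTree, u.numNodes ≤ n → f u = ∑ i ∈ S, if τ i = u then w i else 0

theorem isExpansion_self (n : ℕ) (f : Series A) : IsExpansion n f (treesUpTo n) f id := by
  intro u hu
  simp [mem_treesUpTo, hu]

/-- Orders add under `op`, so coefficients of a product up to order `n` only involve coefficients up
to order `n`. Identities between series thus reduce to identities between trees. -/
theorem IsExpansion.conv {n : ℕ} {f g : Series A} {ι κ : Type*} {S : Finset ι} {w : ι → A}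
    {τ : ι → PBTree} {S' : Finset κ} {w' : κ → A} {τ' : κ → PBTree}
    (hf : IsExpansion n f S w τ) (hg : IsExpansion n g S' w' τ')
    {op : PBTree → PBTree → PBTree} {P : PBTree → Finset (PBTree × PBTree)}
    (hop : ∀ t s, (op t s).numNodes = t.numNodes + s.numNodes)
    (hP : ∀ u p, p ∈ P u ↔ op p.1 p.2 = u) :
    IsExpansion n (fun u => ∑ p ∈ P u, f p.1 * g p.2) (S ×ˢ S') (fun x => w x.1 * w' x.2)
      (fun x => op (τ x.1) (τ' x.2)) := by
  intro u hu
  have h1 : ∀ p ∈ P u, f p.1 * g p.2 = ∑ x ∈ S ×ˢ S',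
      if (τ x.1, τ' x.2) = p then w x.1 * w' x.2 else 0 := by
    rintro ⟨p, q⟩ hp
    have h := hop p q
    rw [(hP u (p, q)).1 hp] at h
    rw [hf p (by omega), hg q (by omega), Finset.sum_mul_sum, Finset.sum_product]
    refine Finset.sum_congr rfl fun i _ => Finset.sum_congr rfl fun j _ => ?_
    by_cases h1 : τ i = p <;> by_cases h2 : τ' j = q <;> simp [h1, h2]
  dsimp only
  rw [Finset.sum_congr rfl h1, Finset.sum_comm]
  refine Finset.sum_congr rfl fun x _ => ?_
  rw [Finset.sum_ite_eq]
  simp only [hP]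

theorem IsExpansion.over {n : ℕ} {f g : Series A} {ι κ : Type*} {S : Finset ι} {w : ι → A}
    {τ : ι → PBTree} {S' : Finset κ} {w' : κ → A} {τ' : κ → PBTree}
    (hf : IsExpansion n f S w τ) (hg : IsExpansion n g S' w' τ') :
    IsExpansion n (overMul f g) (S ×ˢ S') (fun x => w x.1 * w' x.2)
      (fun x => overT (τ x.1) (τ' x.2)) :=
  hf.conv hg numNodes_over fun _ _ => mem_overPairs

theorem IsExpansion.under {n : ℕ} {f g : Series A} {ι κ : Type*} {S : Finset ι} {w : ι → A}
    {τ : ι → PBTree} {S' : Finset κ} {w' : κ → A} {τ' : κ → PBTree}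
    (hf : IsExpansion n f S w τ) (hg : IsExpansion n g S' w' τ') :
    IsExpansion n (underMul f g) (S ×ˢ S') (fun x => w x.1 * w' x.2)
      (fun x => underT (τ x.1) (τ' x.2)) :=
  hf.conv hg numNodes_under fun _ _ => mem_underPairs

theorem isExpansion_X (n : ℕ) (t : PBTree) :
    IsExpansion n (X t : Series A) {()} (fun _ => 1) (fun _ => t) := by
  intro u _
  simp [X, Pi.single_apply, eq_comm]

theorem overMul_X_X (t s : PBTree) : overMul (X t) (X s) = (X (overT t s) : Series A) := by
  funext u
  rw [((isExpansion_X _ t).over (isExpansion_X _ s)) u le_rfl, isExpansion_X _ _ u le_rfl]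
  simp

theorem underMul_X_X (t s : PBTree) : underMul (X t) (X s) = (X (underT t s) : Series A) := by
  funext u
  rw [((isExpansion_X _ t).under (isExpansion_X _ s)) u le_rfl, isExpansion_X _ _ u le_rfl]
  simp

theorem underMul_assoc (f g h : Series A) :
    underMul (underMul f g) h = underMul f (underMul g h) := by
  funext u
  have F := isExpansion_self u.numNodes f
  have G := isExpansion_self u.numNodes g
  have H := isExpansion_self u.numNodes h
  rw [((F.under G).under H) u le_rfl, (F.under (G.under H)) u le_rfl]
  simp only [Finset.sum_product, id, under_assoc, mul_assoc]

theorem overMul_underMul (f h : Series A) {g : Series A} (hg : g .nil = 0) :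
    overMul f (underMul g h) = underMul (overMul f g) h := by
  funext u
  have F := isExpansion_self u.numNodes f
  have G := isExpansion_self u.numNodes g
  have H := isExpansion_self u.numNodes h
  rw [((F.over G).under H) u le_rfl, (F.over (G.under H)) u le_rfl]
  simp only [Finset.sum_product, id, mul_assoc]
  refine Finset.sum_congr rfl fun p _ => Finset.sum_congr rfl fun q _ =>
    Finset.sum_congr rfl fun r _ => ?_
  -- The tree identity fails for `q = .nil`; that term vanishes because `g` has no constant term.
  by_cases hq : q = .nil
  · simp [hq, hg]
  · rw [over_under p r hq]

theorem X_nil_overMul (f : Series A) : overMul (X .nil) f = f := by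
  funext u
  have F := isExpansion_self u.numNodes f
  rw [((isExpansion_X _ .nil).over F) u le_rfl, F u le_rfl]
  simp [nil_over]

theorem X_nil_underMul (f : Series A) : underMul (X .nil) f = f := by
  funext u
  have F := isExpansion_self u.numNodes f
  rw [((isExpansion_X _ .nil).under F) u le_rfl, F u le_rfl]
  simp [underT]

theorem underMul_X_nil (f : Series A) : underMul f (X .nil) = f := by
  funext u
  have F := isExpansion_self u.numNodes f
  rw [(F.under (isExpansion_X _ .nil)) u le_rfl, F u le_rfl]
  simp [under_nil]

theorem underMul_add (f g h : Series A) :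
    underMul f (g + h) = underMul f g + underMul f h := by
  funext u
  simp [underMul, mul_add, Finset.sum_add_distrib]

theorem overMul_sub (f g h : Series A) : overMul f (g - h) = overMul f g - overMul f h := by
  funext u
  simp [overMul, mul_sub]

/-- A tree with a root vertex is `p / (vertex \ q)` for exactly one pair, its two branches. -/
theorem overMul_V (g f : Series A) (l r : PBTree) :
    overMul g (underMul (X vertex) f) (.node () l r) = g l * f r := by
  set u : PBTree := .node () l r with hu
  have F := isExpansion_self u.numNodes f
  have G := isExpansion_self u.numNodes g
  have hl : l ∈ treesUpTo u.numNodes := by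
    rw [mem_treesUpTo, hu]; simp only [BinaryTree.numNodes]; omega
  have hr : r ∈ treesUpTo u.numNodes := by
    rw [mem_treesUpTo, hu]; simp only [BinaryTree.numNodes]; omega
  rw [(G.over ((isExpansion_X _ vertex).under F)) u le_rfl]
  have key : ∀ p q : PBTree, overT p (underT vertex q) = u ↔ p = l ∧ q = r := by
    intro p q
    change BinaryTree.node () p q = u ↔ _
    simp [hu]
  simp only [Finset.sum_product, Finset.sum_singleton, id, key, one_mul]
  rw [Finset.sum_eq_single l, Finset.sum_eq_single r] <;> simp_all

end Expansion

/-! ### Substitution of a series for the vertex tree -/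

section Substitution

variable {A : Type*} [CommRing A]

/-- The series obtained from the tree `t`, written as a monomial in the vertex tree, by replacing
every copy of the vertex tree by the series `ψ`. -/
noncomputable def subst (ψ : Series A) : PBTree → Series A
  | .nil => X .nil
  | .node _ l r => underMul (overMul (subst ψ l) ψ) (subst ψ r)

/-- The linear and continuous extension of `subst ψ` to series. -/
noncomputable def evalAt (ψ f : Series A) : Series A :=
  fun u => ∑ t ∈ treesUpTo u.numNodes, f t * subst ψ t u

/-- Links the recursive `subst` to the explicit `mu`: expanding each copy of `ψ` gives one term per
assignment of trees to the vertices of `t`. -/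
theorem isExpansion_subst (n : ℕ) (ψ : Series A) (t : PBTree) :
    IsExpansion n (subst ψ t) (Fintype.piFinset fun _ : Fin t.numNodes => treesUpTo n)
      (fun s => ∏ i, ψ (s i)) (mu t) := by
  induction t with
  | nil =>
    intro u hu
    rw [subst, isExpansion_X n .nil u hu]
    have : IsEmpty (Fin (BinaryTree.nil : PBTree).numNodes) := inferInstanceAs (IsEmpty (Fin 0))
    have h : ∀ f : (Fin (BinaryTree.nil : PBTree).numNodes → PBTree) → A,
        ∑ s ∈ Fintype.piFinset fun _ => treesUpTo n, f s = f isEmptyElim := fun f =>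
      Finset.sum_eq_single _ (fun s _ hs => absurd (Subsingleton.elim s _) hs)
        fun hs => absurd (Fintype.mem_piFinset.2 isEmptyElim) hs
    simp only [h, mu, Finset.sum_singleton]
    exact congrArg (fun a : A => if .nil = u then a else 0) (Finset.prod_of_isEmpty _).symm
  | node a l r ihl ihr =>
    intro u hu
    rw [subst, ((ihl.over (isExpansion_self n ψ)).under ihr) u hu]
    symm
    refine Finset.sum_bij'
      (fun s _ => (((fun i : Fin l.numNodes => s ⟨i, by
          have := i.isLt; simp only [BinaryTree.numNodes]; omega⟩),
        s ⟨l.numNodes, by simp only [BinaryTree.numNodes]; omega⟩),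
        fun i : Fin r.numNodes => s ⟨l.numNodes + 1 + i, by
          have := i.isLt; simp only [BinaryTree.numNodes]; omega⟩))
      (fun x _ => nodeFamily x.1.1 x.1.2 x.2) ?_ ?_ ?_ ?_ ?_
    · intro s hs
      simp only [Fintype.mem_piFinset, Finset.mem_product] at hs ⊢
      exact ⟨⟨fun i => hs _, hs _⟩, fun i => hs _⟩
    · rintro ⟨⟨a, b⟩, c⟩ hx
      simp only [Fintype.mem_piFinset, Finset.mem_product] at hx ⊢
      exact nodeFamily_forall hx.1.1 hx.1.2 hx.2
    · intro s _
      funext i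
      unfold nodeFamily
      split_ifs with h1 h2
      · rfl
      · exact congrArg s (Fin.ext h2.symm)
      · exact congrArg s (Fin.ext (by
          change l.numNodes + 1 + (i.1 - (l.numNodes + 1)) = i.1
          omega))
    · rintro ⟨⟨a, b⟩, c⟩ _
      simp only [nodeFamily_left, nodeFamily_mid, nodeFamily_right]
    · intro s _
      dsimp only
      rw [prod_node]
      rfl

theorem subst_nil (ψ : Series A) : subst ψ .nil = X .nil := rfl

theorem subst_vertex (ψ : Series A) : subst ψ vertex = ψ := by
  rw [vertex, subst, subst_nil, X_nil_overMul, underMul_X_nil]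

/-- Each of the `|t|` substituted trees has order at least `1`, unless its coefficient in `ψ` is
zero. -/
theorem subst_apply_eq_zero {ψ : Series A} (hψ : ψ .nil = 0) {t u : PBTree}
    (h : u.numNodes < t.numNodes) : subst ψ t u = 0 := by
  rw [isExpansion_subst u.numNodes ψ t u le_rfl]
  refine Finset.sum_eq_zero fun s _ => ?_
  split_ifs with hs
  · by_cases hn : ∃ i, s i = .nil
    · obtain ⟨i, hi⟩ := hn
      exact Finset.prod_eq_zero (Finset.mem_univ i) (by rw [hi, hψ])
    · push Not at hn
      have h1 : t.numNodes ≤ u.numNodes := by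
        rw [← hs, numNodes_mu]
        calc t.numNodes = ∑ _i : Fin t.numNodes, 1 := by simp
          _ ≤ _ := Finset.sum_le_sum fun i _ => numNodes_pos (hn i)
      omega
  · rfl

theorem subst_apply_of_numNodes_eq {ψ : Series A} (hψ : ψ .nil = 0) (hv : ψ vertex = 1)
    {t u : PBTree} (h : u.numNodes = t.numNodes) : subst ψ t u = if t = u then 1 else 0 := by
  -- The bound `1 ≤ |u|` is needed below for the vertex tree to lie in `treesUpTo u.numNodes`.
  by_cases hu : u = .nil
  · subst hu
    cases t with
    | nil => simp [subst_nil, X]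
    | node a l r => simp at h
  rw [isExpansion_subst u.numNodes ψ t u le_rfl, Finset.sum_eq_single fun _ => vertex]
  · simp [mu_vertex, hv]
  · intro s _ hne
    split_ifs with hs
    · by_cases hn : ∃ i, s i = .nil
      · obtain ⟨i, hi⟩ := hn
        exact Finset.prod_eq_zero (Finset.mem_univ i) (by rw [hi, hψ])
      · push Not at hn
        refine absurd (funext fun i => ?_) hne
        -- Every summand on the right is at least `1`, so equality of the sums forces each `s i` to
        -- have order `1`.
        have h1 : ∑ _i : Fin t.numNodes, 1 = ∑ i, (s i).numNodes := by
          rw [← numNodes_mu, hs, h]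
          simp
        rw [Finset.sum_eq_sum_iff_of_le fun i _ => numNodes_pos (hn i)] at h1
        exact eq_vertex_of_numNodes (h1 i (Finset.mem_univ i)).symm
    · rfl
  · intro hne
    refine absurd (Fintype.mem_piFinset.2 fun _ => ?_) hne
    rw [mem_treesUpTo, numNodes_vertex]
    exact numNodes_pos hu

theorem subst_apply_nil {ψ : Series A} (hψ : ψ .nil = 0) {t : PBTree} (ht : t ≠ .nil) :
    subst ψ t .nil = 0 :=
  subst_apply_eq_zero hψ (numNodes_pos ht)

theorem subst_over {ψ : Series A} (hψ : ψ .nil = 0) (t s : PBTree) :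
    subst ψ (overT t s) = overMul (subst ψ t) (subst ψ s) := by
  induction s with
  | nil => rw [overT, subst_nil, overMul_X_nil]
  | node a l r ihl _ =>
    rw [overT, subst, subst, ihl, overMul_assoc, overMul_underMul]
    rw [overMul_nil, hψ, mul_zero]

theorem subst_under (ψ : Series A) (t s : PBTree) :
    subst ψ (underT t s) = underMul (subst ψ t) (subst ψ s) := by
  induction t with
  | nil => rw [underT, subst_nil, X_nil_underMul]
  | node a l r _ ihr => rw [underT, subst, subst, ihr, underMul_assoc]

/-- The truncation in `evalAt` loses nothing: trees of order above `|u|` contribute zero to the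
coefficient of `u`. -/
theorem IsExpansion.evalAt {n : ℕ} {f ψ : Series A} (hψ : ψ .nil = 0) {ι : Type*} {S : Finset ι}
    {w : ι → A} {τ : ι → PBTree} (hf : IsExpansion n f S w τ) {u : PBTree}
    (hu : u.numNodes ≤ n) :
    evalAt ψ f u = ∑ i ∈ S, w i * subst ψ (τ i) u := by
  have h1 : ∀ t ∈ treesUpTo u.numNodes, f t * subst ψ t u =
      ∑ i ∈ S, if τ i = t then w i * subst ψ t u else 0 := by
    intro t ht
    rw [hf t ((mem_treesUpTo.1 ht).trans hu), Finset.sum_mul]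
    simp only [ite_mul, zero_mul]
  rw [TreeSeries.evalAt, Finset.sum_congr rfl h1, Finset.sum_comm]
  refine Finset.sum_congr rfl fun i _ => ?_
  rw [Finset.sum_ite_eq]
  split_ifs with h
  · rfl
  · rw [mem_treesUpTo, not_le] at h
    rw [subst_apply_eq_zero hψ h, mul_zero]

theorem evalAt_conv {ψ : Series A} (hψ : ψ .nil = 0) (f g : Series A)
    {op : PBTree → PBTree → PBTree} {P : PBTree → Finset (PBTree × PBTree)}
    (hop : ∀ t s, (op t s).numNodes = t.numNodes + s.numNodes)
    (hP : ∀ u p, p ∈ P u ↔ op p.1 p.2 = u)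
    (hs : ∀ t s u, subst ψ (op t s) u = ∑ p ∈ P u, subst ψ t p.1 * subst ψ s p.2) :
    evalAt ψ (fun u => ∑ p ∈ P u, f p.1 * g p.2) =
      fun u => ∑ p ∈ P u, evalAt ψ f p.1 * evalAt ψ g p.2 := by
  funext u
  have F := isExpansion_self u.numNodes f
  have G := isExpansion_self u.numNodes g
  rw [(F.conv G hop hP).evalAt hψ le_rfl]
  have h1 : ∀ p ∈ P u, evalAt ψ f p.1 * evalAt ψ g p.2 =
      ∑ x ∈ treesUpTo u.numNodes ×ˢ treesUpTo u.numNodes,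
        f x.1 * g x.2 * (subst ψ x.1 p.1 * subst ψ x.2 p.2) := by
    intro p hp
    have h := hop p.1 p.2
    rw [(hP u p).1 hp] at h
    rw [F.evalAt hψ (by omega), G.evalAt hψ (by omega), Finset.sum_mul_sum, Finset.sum_product]
    refine Finset.sum_congr rfl fun i _ => Finset.sum_congr rfl fun j _ => ?_
    simp only [id]
    ring
  rw [Finset.sum_congr rfl h1, Finset.sum_comm]
  refine Finset.sum_congr rfl fun x _ => ?_
  simp only [id]
  rw [hs, Finset.mul_sum]

theorem evalAt_overMul {ψ : Series A} (hψ : ψ .nil = 0) (f g : Series A) :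
    evalAt ψ (overMul f g) = overMul (evalAt ψ f) (evalAt ψ g) :=
  evalAt_conv hψ f g numNodes_over (fun _ _ => mem_overPairs)
    fun t s u => by rw [subst_over hψ, overMul]

theorem evalAt_underMul {ψ : Series A} (hψ : ψ .nil = 0) (f g : Series A) :
    evalAt ψ (underMul f g) = underMul (evalAt ψ f) (evalAt ψ g) :=
  evalAt_conv hψ f g numNodes_under (fun _ _ => mem_underPairs)
    fun t s u => by rw [subst_under, underMul]

theorem evalAt_X {ψ : Series A} (hψ : ψ .nil = 0) (t : PBTree) : evalAt ψ (X t) = subst ψ t := by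
  funext u
  rw [(isExpansion_X u.numNodes t).evalAt hψ le_rfl]
  simp

theorem evalAt_sub (ψ f g : Series A) : evalAt ψ (f - g) = evalAt ψ f - evalAt ψ g := by
  funext u
  simp [evalAt, sub_mul]

theorem evalAt_apply_nil {ψ : Series A} (hψ : ψ .nil = 0) (f : Series A) :
    evalAt ψ f .nil = f .nil := by
  rw [evalAt, Finset.sum_eq_single .nil]
  · simp [subst_nil, X]
  · intro t _ ht
    rw [subst_apply_nil hψ ht, mul_zero]
  · intro h
    exact absurd (mem_treesUpTo.2 le_rfl) h

/-- Unitriangularity with respect to the order, which is what the recursion `evalInv` inverts. -/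
theorem evalAt_apply_eq {ψ : Series A} (hψ : ψ .nil = 0) (hv : ψ vertex = 1) (f : Series A)
    (u : PBTree) : evalAt ψ f u =
      f u + ∑ t ∈ treesUpTo u.numNodes with t.numNodes < u.numNodes, f t * subst ψ t u := by
  rw [evalAt, ← Finset.sum_filter_add_sum_filter_not _ fun t => t.numNodes < u.numNodes, add_comm]
  congr 1
  rw [Finset.sum_eq_single u]
  · rw [subst_apply_of_numNodes_eq hψ hv rfl]
    simp
  · intro t ht hne
    rw [Finset.mem_filter, mem_treesUpTo] at ht
    rw [subst_apply_of_numNodes_eq hψ hv (by omega), if_neg hne, mul_zero]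
  · intro h
    exact absurd (Finset.mem_filter.2 ⟨mem_treesUpTo.2 le_rfl, lt_irrefl _⟩) h

theorem evalAt_apply_vertex {ψ : Series A} (hψ : ψ .nil = 0) (hv : ψ vertex = 1) {f : Series A}
    (hf : f .nil = 0) : evalAt ψ f vertex = f vertex := by
  rw [evalAt_apply_eq hψ hv, Finset.sum_eq_zero, add_zero]
  intro t ht
  have h : t.numNodes = 0 := by
    have := (Finset.mem_filter.1 ht).2
    rw [numNodes_vertex] at this
    omega
  cases t with
  | nil => rw [hf, zero_mul]
  | node a l r => simp at h

/-- The solution `f` of `evalAt ψ f = h`, by recursion on the order of trees. -/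
noncomputable def evalInv (ψ h : Series A) (u : PBTree) : A :=
  h u - ∑ t ∈ ({t ∈ treesUpTo u.numNodes | t.numNodes < u.numNodes} : Finset PBTree).attach,
    have : t.1.numNodes < u.numNodes := (Finset.mem_filter.1 t.2).2
    evalInv ψ h t.1 * subst ψ t.1 u
termination_by u.numNodes

theorem evalAt_evalInv {ψ : Series A} (hψ : ψ .nil = 0) (hv : ψ vertex = 1) (h : Series A) :
    evalAt ψ (evalInv ψ h) = h := by
  funext u
  rw [evalAt_apply_eq hψ hv]
  nth_rewrite 1 [evalInv]
  rw [← Finset.sum_attach ({t ∈ treesUpTo u.numNodes | t.numNodes < u.numNodes} : Finset PBTree)]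
  simp

theorem comp_eq_evalAt {φ ψ : Series A} (hφ : φ .nil = 0) (hψ : ψ .nil = 0) :
    comp φ ψ = evalAt ψ φ := by
  funext u
  have h1 : ∀ t ∈ treesUpTo u.numNodes, φ t * subst ψ t u =
      ∑ s ∈ Fintype.piFinset fun _ : Fin t.numNodes => treesUpTo u.numNodes,
        if mu t s = u then φ t * ∏ i, ψ (s i) else 0 := by
    intro t _
    rw [isExpansion_subst u.numNodes ψ t u le_rfl, Finset.mul_sum]
    simp only [mul_ite, mul_zero]
  rw [evalAt, Finset.sum_congr rfl h1, Finset.sum_sigma', comp]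
  rw [← Finset.sum_filter (p := fun x : Σ t : PBTree, (Fin t.numNodes → PBTree) => mu x.1 x.2 = u)
    (f := fun x => φ x.1 * ∏ i, ψ (x.2 i))]
  -- The extra terms of the larger sum involve the root tree, where `φ` or `ψ` vanishes.
  refine Finset.sum_subset ?_ ?_
  · rintro ⟨t, s⟩ hx
    obtain ⟨-, hs, rfl⟩ := mem_muTuples.1 hx
    dsimp only at hs
    simp only [Finset.mem_filter, Finset.mem_sigma, Fintype.mem_piFinset, mem_treesUpTo,
      numNodes_mu, and_true]
    refine ⟨?_, fun i => Finset.single_le_sum (f := fun i => (s i).numNodes)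
      (fun _ _ => Nat.zero_le _) (Finset.mem_univ i)⟩
    calc t.numNodes = ∑ _i : Fin t.numNodes, 1 := by simp
      _ ≤ _ := Finset.sum_le_sum fun i _ => numNodes_pos (hs i)
  · rintro ⟨t, s⟩ hx hn
    rw [Finset.mem_filter] at hx
    rw [mem_muTuples] at hn
    dsimp only at hx hn ⊢
    by_cases ht : t = .nil
    · rw [show φ t = 0 by rw [ht, hφ], zero_mul]
    · by_cases hs : ∃ i, s i = .nil
      · obtain ⟨i, hi⟩ := hs
        rw [Finset.prod_eq_zero (Finset.mem_univ i) (by rw [hi, hψ]), mul_zero]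
      · push Not at hs
        exact absurd ⟨ht, hs, hx.2⟩ hn

theorem evalAt_evalAt {ψ χ : Series A} (hψ : ψ .nil = 0) (hχ : χ .nil = 0) (f : Series A) :
    evalAt χ (evalAt ψ f) = evalAt (evalAt χ ψ) f := by
  have hψχ : evalAt χ ψ .nil = 0 := by rw [evalAt_apply_nil hχ, hψ]
  have hs : ∀ t, evalAt χ (subst ψ t) = subst (evalAt χ ψ) t := by
    intro t
    induction t with
    | nil => rw [subst_nil, subst_nil, evalAt_X hχ, subst_nil]
    | node a l r ihl ihr =>
      rw [subst, subst, evalAt_underMul hχ, evalAt_overMul hχ, ihl, ihr]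
  funext u
  have h1 : ∀ t ∈ treesUpTo u.numNodes, evalAt ψ f t * subst χ t u =
      ∑ s ∈ treesUpTo u.numNodes, f s * (subst ψ s t * subst χ t u) := by
    intro t ht
    rw [(isExpansion_self u.numNodes f).evalAt hψ (mem_treesUpTo.1 ht), Finset.sum_mul]
    simp only [id, mul_assoc]
  rw [evalAt, Finset.sum_congr rfl h1, Finset.sum_comm, evalAt]
  refine Finset.sum_congr rfl fun s _ => ?_
  rw [← hs, evalAt, Finset.mul_sum]

theorem subst_X_vertex (t : PBTree) : subst (X vertex) t = (X t : Series A) := by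
  induction t with
  | nil => rfl
  | node a l r ihl ihr =>
    rw [subst, ihl, ihr, overMul_X_X, underMul_X_X]
    rfl

theorem X_vertex_nil : (X vertex : Series A) .nil = 0 := by
  simp [X, vertex]

theorem X_vertex_vertex : (X vertex : Series A) vertex = 1 := by
  simp [X]

theorem evalAt_X_vertex (f : Series A) : evalAt (X vertex) f = f := by
  funext u
  rw [evalAt, isExpansion_self u.numNodes f u le_rfl]
  refine Finset.sum_congr rfl fun t _ => ?_
  rw [subst_X_vertex]
  by_cases h : t = u
  · simp [X, h]
  · simp [X, Ne.symm h, h]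

end Substitution

/-! ### The group of formal diffeomorphisms and its subgroups -/

section Groups

variable {A : Type*} [CommRing A]

/-- The composition of formal diffeomorphisms. -/
noncomputable abbrev GDif.mul : Mul (GDif A) :=
  ⟨fun φ ψ => ⟨evalAt ψ.1 φ.1, by rw [evalAt_apply_nil ψ.2.1, φ.2.1],
    by rw [evalAt_apply_vertex ψ.2.1 ψ.2.2 φ.2.1, φ.2.2]⟩⟩

/-- The unit for the composition. -/
abbrev GDif.one : One (GDif A) := ⟨⟨X vertex, X_vertex_nil, X_vertex_vertex⟩⟩

/-- The inverse for the composition. -/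
noncomputable abbrev GDif.inv : Inv (GDif A) :=
  ⟨fun ψ => ⟨evalInv ψ.1 (X vertex), by
    have h := evalAt_evalInv ψ.2.1 ψ.2.2 (X vertex)
    have h0 : evalInv ψ.1 (X vertex) .nil = 0 := by
      rw [← evalAt_apply_nil ψ.2.1 (evalInv ψ.1 (X vertex)), h, X_vertex_nil]
    exact ⟨h0, by rw [← evalAt_apply_vertex ψ.2.1 ψ.2.2 h0, h, X_vertex_vertex]⟩⟩⟩

attribute [local instance] GDif.mul GDif.one GDif.inv

theorem GDif.mul_val (φ ψ : GDif A) : (φ * ψ).1 = evalAt ψ.1 φ.1 := rfl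

theorem GDif.one_val : (1 : GDif A).1 = X vertex := rfl

/-- The group of tree-expanded formal diffeomorphisms, with unit `x^vertex`. -/
noncomputable abbrev GDif.group : Group (GDif A) :=
  Group.ofLeftAxioms
    (fun φ ψ χ => Subtype.ext (evalAt_evalAt ψ.2.1 χ.2.1 φ.1))
    (fun φ => Subtype.ext (by rw [GDif.mul_val, GDif.one_val, evalAt_X φ.2.1, subst_vertex]))
    (fun φ => Subtype.ext (evalAt_evalInv φ.2.1 φ.2.2 (X vertex)))

attribute [local instance] GDif.group

theorem evalAt_evalAt_inv (χ : GDif A) (f : Series A) :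
    evalAt χ.1 (evalAt (χ⁻¹).1 f) = f := by
  rw [evalAt_evalAt (χ⁻¹).2.1 χ.2.1, ← GDif.mul_val, inv_mul_cancel, GDif.one_val,
    evalAt_X_vertex]

/-- Substitution of a formal diffeomorphism in an invertible series. -/
noncomputable def evalOver (χ : GDif A) : GOver A →* GOver A :=
  MonoidHom.mk' (fun g => ⟨evalAt χ.1 g.1, by rw [evalAt_apply_nil χ.2.1, g.2]⟩)
    fun f g => Subtype.ext (evalAt_overMul χ.2.1 f.1 g.1)

theorem evalOver_val (χ : GDif A) (g : GOver A) : (evalOver χ g).1 = evalAt χ.1 g.1 := rfl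

theorem GOver.mul_val (f g : GOver A) : (f * g).1 = overMul f.1 g.1 := rfl

theorem GOver.one_val : (1 : GOver A).1 = X .nil := rfl

theorem rho_apply_nil (g : Series A) : rho g .nil = 0 := by
  rw [rho, overMul_nil, X_vertex_nil, mul_zero]

theorem overMul_rho (f g : Series A) : overMul f (rho g) = rho (overMul f g) :=
  (overMul_assoc f g (X vertex)).symm

theorem rho_apply_vertex (g : GOver A) : rho g.1 vertex = 1 := by
  have h : rho g.1 = overMul g.1 (underMul (X vertex) (X .nil)) := by rw [underMul_X_nil, rho]
  rw [h]
  change overMul g.1 (underMul (X vertex) (X .nil)) (.node () .nil .nil) = 1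
  rw [overMul_V, g.2]
  simp [X]

/-- The formal diffeomorphism `ρ_g`. -/
noncomputable def rhoDif (g : GOver A) : GDif A := ⟨rho g.1, rho_apply_nil g.1, rho_apply_vertex g⟩

theorem rhoDif_mul (f : GOver A) (g : GOver A) :
    rhoDif f * rhoDif g = rhoDif (evalOver (rhoDif g) f * g) := by
  apply Subtype.ext
  rw [GDif.mul_val]
  change evalAt (rhoDif g).1 (overMul f.1 (X vertex)) = rho (overMul _ g.1)
  rw [evalAt_overMul (rhoDif g).2.1, evalAt_X (rhoDif g).2.1, subst_vertex, evalOver_val,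
    ← overMul_rho]
  rfl

theorem rhoDif_one : rhoDif (1 : GOver A) = 1 :=
  Subtype.ext (X_nil_overMul (X vertex))

/-- Solves `f(ρ_g) / g = x^nil` for `f`: substitute `ρ_g⁻¹` in `g⁻¹`. -/
theorem rhoDif_inv (g : GOver A) :
    (rhoDif g)⁻¹ = rhoDif (evalOver (rhoDif g)⁻¹ g⁻¹) := by
  symm
  rw [eq_inv_iff_mul_eq_one, rhoDif_mul]
  have h : evalOver (rhoDif g) (evalOver (rhoDif g)⁻¹ g⁻¹) = g⁻¹ :=
    Subtype.ext (evalAt_evalAt_inv _ _)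
  rw [h, inv_mul_cancel, rhoDif_one]

/-- The subgroup of the series `ρ_g`. -/
noncomputable def rhoSubgroup (A : Type*) [CommRing A] : Subgroup (GDif A) where
  carrier := Set.range rhoDif
  mul_mem' := by
    rintro _ _ ⟨f, rfl⟩ ⟨g, rfl⟩
    exact ⟨_, (rhoDif_mul f g).symm⟩
  one_mem' := ⟨1, rhoDif_one⟩
  inv_mem' := by
    rintro _ ⟨g, rfl⟩
    exact ⟨_, (rhoDif_inv g).symm⟩

/-- The formal diffeomorphism `α_f`. -/
noncomputable def alphaDif (f : Series A) : GDif A := rhoDif (oneSub f)⁻¹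

theorem oneSub_val (f : Series A) : (oneSub f).1 = X .nil - underMul (X vertex) f := rfl

theorem oneSub_overMul_alpha (h : Series A) :
    overMul (oneSub h).1 (alphaDif h).1 = X vertex := by
  change overMul (oneSub h).1 (rho ((oneSub h)⁻¹).1) = _
  rw [overMul_rho, ← GOver.mul_val, mul_inv_cancel]
  exact X_nil_overMul _

/-- Substituting `α_h` turns `x^vertex \ f` into `α_h \ f(α_h)`. As `α_h` has no constant term, the
left factor can be absorbed into it, and it becomes `x^vertex` again by `oneSub_overMul_alpha`. -/
theorem oneSub_mul (f h : Series A) :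
    oneSub h * evalOver (alphaDif h) (oneSub f) = oneSub (h + evalAt (alphaDif h).1 f) := by
  apply Subtype.ext
  have hχ := (alphaDif h).2.1
  rw [GOver.mul_val, evalOver_val, oneSub_val f, evalAt_sub, evalAt_underMul hχ, evalAt_X hχ,
    evalAt_X hχ, subst_nil, subst_vertex, overMul_sub, overMul_X_nil, overMul_underMul _ _ hχ,
    oneSub_overMul_alpha, oneSub_val, oneSub_val, underMul_add, sub_sub]

theorem alphaDif_mul (f h : Series A) :
    alphaDif f * alphaDif h = alphaDif (h + evalAt (alphaDif h).1 f) := by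
  rw [alphaDif, alphaDif, rhoDif_mul, map_inv, ← mul_inv_rev]
  change rhoDif (oneSub h * evalOver (alphaDif h) (oneSub f))⁻¹ = _
  rw [oneSub_mul]
  rfl

theorem alphaDif_zero : alphaDif (0 : Series A) = 1 := by
  have h : oneSub (0 : Series A) = 1 := by
    apply Subtype.ext
    rw [oneSub_val, GOver.one_val]
    have : underMul (X vertex) (0 : Series A) = 0 := by
      funext u
      simp [underMul]
    rw [this, sub_zero]
  rw [alphaDif, h, inv_one, rhoDif_one]

/-- Solves `h + f(α_h) = 0` for `f`. -/
theorem alphaDif_inv (h : Series A) :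
    (alphaDif h)⁻¹ = alphaDif (evalAt ((alphaDif h)⁻¹).1 (-h)) := by
  symm
  rw [eq_inv_iff_mul_eq_one, alphaDif_mul, evalAt_evalAt_inv, add_neg_cancel, alphaDif_zero]

/-- The subgroup of the series `α_f`. -/
noncomputable def alphaSubgroup (A : Type*) [CommRing A] : Subgroup (GDif A) where
  carrier := Set.range alphaDif
  mul_mem' := by
    rintro _ _ ⟨f, rfl⟩ ⟨g, rfl⟩
    exact ⟨_, (alphaDif_mul f g).symm⟩
  one_mem' := ⟨0, alphaDif_zero⟩
  inv_mem' := by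
    rintro _ ⟨g, rfl⟩
    exact ⟨_, (alphaDif_inv g).symm⟩

theorem alphaSubgroup_le : alphaSubgroup A ≤ rhoSubgroup A := by
  rintro _ ⟨f, rfl⟩
  exact ⟨_, rfl⟩

end Groups

/-! ### Multiplicativity of the coefficients -/

section Multiplicativity

variable {A : Type*} [CommRing A]

theorem eq_inv_oneSub_iff (g : GOver A) (f : Series A) :
    g = (oneSub f)⁻¹ ↔ ∀ l r, g.1 (.node () l r) = g.1 l * f r := by
  have h : (g * oneSub f).1 = g.1 - overMul g.1 (underMul (X vertex) f) := by
    rw [GOver.mul_val, oneSub_val, overMul_sub, overMul_X_nil]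
  rw [eq_inv_iff_mul_eq_one]
  constructor
  · intro hg l r
    have h1 := congrFun h (.node () l r)
    rw [hg, Pi.sub_apply, overMul_V] at h1
    rw [← sub_eq_zero, ← h1, GOver.one_val]
    simp [X]
  · intro hg
    apply Subtype.ext
    funext u
    cases u with
    | nil => rw [(g * oneSub f).2, (1 : GOver A).2]
    | node a l r =>
      rw [h, Pi.sub_apply, overMul_V, ← hg, sub_self, GOver.one_val]
      simp [X]

/-- Every tree is an over product of trees `V t`, and `node () l r = l / V r` splits off the last
factor. -/
theorem multiplicative_iff (g : GOver A) :
    (∀ l : List PBTree, l ≠ [] → g.1 (overProd (l.map V)) = (l.map fun t => g.1 (V t)).prod) ↔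
      ∀ l r, g.1 (.node () l r) = g.1 l * g.1 (V r) := by
  constructor
  · intro h p r
    obtain ⟨l, rfl⟩ := exists_eq_overProd_map_V p
    have h1 := h (l ++ [r]) (by simp)
    rw [List.map_append, List.map_singleton, overProd_append, over_V, List.map_append,
      List.prod_append, List.map_singleton, List.prod_singleton] at h1
    rw [h1]
    cases l with
    | nil => simp [overProd, g.2]
    | cons a l => rw [h (a :: l) (by simp)]
  · intro h l _
    induction l using List.reverseRecOn with
    | nil => simp [overProd, g.2]
    | append_singleton l r ih =>
      rw [List.map_append, List.map_singleton, overProd_append, over_V, List.map_append,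
        List.prod_append, List.map_singleton, List.prod_singleton, h]
      by_cases hl : l = []
      · subst hl
        simp [overProd, g.2]
      · rw [ih hl]

theorem GAlpha_eq : GAlpha A = {φ : Series A | ∃ g : GOver A, φ = rho g.1 ∧
    ∀ l : List PBTree, l ≠ [] →
      g.1 (overProd (l.map V)) = (l.map fun t => g.1 (V t)).prod} := by
  ext φ
  constructor
  · rintro ⟨f, rfl⟩
    refine ⟨(oneSub f)⁻¹, rfl, (multiplicative_iff _).2 fun l r => ?_⟩
    have h := (eq_inv_oneSub_iff _ f).1 rfl
    rw [V_eq, h l r, h .nil r, ((oneSub f)⁻¹).2, one_mul]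
  · rintro ⟨g, rfl, hg⟩
    -- This is the only candidate: `g_{V t} = g_nil f_t = f_t`.
    refine ⟨fun t => g.1 (V t), ?_⟩
    rw [alpha, ← (eq_inv_oneSub_iff g _).2 ((multiplicative_iff g).1 hg)]

end Multiplicativity

end TreeSeries

open TreeSeries
theorem mainTheorem1 (A : Type*) [CommRing A] [Algebra ℚ A] :
    -- the description of `GAlpha A` by multiplicativity of the coefficients
    GAlpha A = {φ : Series A | ∃ g : GOver A, φ = rho g.1 ∧
      ∀ l : List PBTree, l ≠ [] →
        g.1 (overProd (l.map V)) = (l.map fun t => g.1 (V t)).prod} ∧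
    -- in the group of tree-expanded diffeomorphisms under composition, `GRho A` is a subgroup
    -- and `GAlpha A` is a subgroup of `GRho A`
    ∃ _ : Group (GDif A),
      (∀ φ ψ : GDif A, (φ * ψ).1 = comp φ.1 ψ.1) ∧
      (1 : GDif A).1 = X vertex ∧
      ∃ R H : Subgroup (GDif A),
        Subtype.val '' (R : Set (GDif A)) = GRho A ∧
        Subtype.val '' (H : Set (GDif A)) = GAlpha A ∧
        H ≤ R := by
  refine ⟨GAlpha_eq, GDif.group, fun φ ψ => ?_, rfl, rhoSubgroup A, alphaSubgroup A, ?_, ?_,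
    alphaSubgroup_le⟩
  · rw [comp_eq_evalAt φ.2.1 ψ.2.1]
    rfl
  · ext φ
    constructor
    · rintro ⟨_, ⟨g, rfl⟩, rfl⟩
      exact ⟨g, rfl⟩
    · rintro ⟨g, rfl⟩
      exact ⟨_, ⟨g, rfl⟩, rfl⟩
  · ext φ
    constructor
    · rintro ⟨_, ⟨f, rfl⟩, rfl⟩
      exact ⟨f, rfl⟩
    · rintro ⟨f, rfl⟩
      exact ⟨_, ⟨f, rfl⟩, rfl⟩
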